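/- Let $d\ge 0$ and let $\widetilde T=\Delta I+[t_{jk}]_{j,k=0}^{d}$ be a generalized complete Taylor operator of order $d$ acting on sequences $c:\mathbb Z\to\mathbb R^{d+1}$, i.e. $\Delta c(\alpha)=c(\alpha+1)-c(\alpha)$, $t_{j,j+1}=-1$, $t_{jk}=0$ for $k\le j$, and the remaining real numbers $t_{jk}$ ($k\ge j+2$) are arbitrary. A mask is a finitely supported sequence $A$ of real $(d+1)\times(d+1)$ matrices; $S_Ac(\alpha)=\sum_{\beta\in\mathbb Z}A(\alpha-2\beta)c(\beta)$, and $A^*(z)=\sum_\alpha A(\alpha)z^\alpha$ is its symbol. $S_B$ is contractive if $\|S_B^n\|_\infty<1$ for some $n$, as an operator on bounded sequences. With $D=\mathrm{diag}(1,\tfrac12,\dots,2^{-d})$, the Hermite scheme $H_A$ is $f_{n+1}(\alpha)=\sum_\beta D^{-n-1}A(\alpha-2\beta)D^nf_n(\beta)$. A continuous $\Phi=[\phi_0,\dots,\phi_d]^T:\mathbb R\to\mathbb R^{d+1}$ is the limit for $f_0$ if, for every compact $K\subset\mathbb R$, $\max_i\sup_{\alpha\in\mathbb Z\cap 2^nK}|f_n^{(i)}(\alpha)-\phi_i(2^{-n}\alpha)|\to0$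 as $n\to\infty$. $H_A$ is $C^d$-convergent if every $f_0:\mathbb Z\to\mathbb R^{d+1}$ has such a limit with $\phi_0\in C^d$ and $\phi_0^{(i)}=\phi_i$, $0\le i\le d$. For polynomials $h_0,\dots,h_d$ put $q_j(z)=(z+1)h_j(z)+\sum_{k=0}^{j-1}t_{kj}(z-1)^{j-1-k}h_k(z)$. Given a real polynomial $h_d$ with $h_d(1)=1$, consider the linear system $$q_j^{(r)}(1)=0,\qquad 1\le r\le j\le d,\qquad (\ast)$$ for the derivatives $h_j^{(r)}(1)$, $0\le j<d$, $1\le r\le j+1$, of real polynomials $h_j$ with $\deg h_j\le j+1$ and $h_j(1)=2^{d-j}$. Then: 1. For every real polynomial $h_d$ with $h_d(1)=1$ the system $(\ast)$ has exactly one solution $(h_0,\dots,h_{d-1})$. 2. There are masks $A$ and $\widetilde B$ such that $\widetilde T S_A=2^{-d}S_{\widetilde B}\widetilde T$, the scheme $S_{\widetilde B}$ is contractive, and the Hermite scheme $H_A$ is $C^d$-convergent. $H_A$ is non-degenerate: for some $f_0$ the limit $\phi_d=\phi_0^{(d)}$ is not identically zero. Moreover, the last row of the symbol of $\widetilde B$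 is, for $z\in\mathbb C\setminus\{0\}$, $$\widetilde b_{dj}^*(z)=(z^{-1}-1)^{d-j}h_j(z^{-1}),\qquad j=0,\dots,d,$$ for some polynomial $h_d$ with $h_d(1)=1$ and the solution $(h_0,\dots,h_{d-1})$ of $(\ast)$; in particular $\widetilde b_{dj}^*(1)=0$ for $j<d$ and $\widetilde b_{dd}^*(1)=1$. -/

import Mathlib

open Polynomial

/-- The vector sequences `ℤ → ℝ^{d+1}`, with components indexed by `0, …, d`. -/
abbrev VecSeq (d : ℕ) : Type := ℤ → Fin (d + 1) → ℝ

/-- Sequences of real `(d+1) × (d+1)` matrices; a mask is such a sequence with finite support. -/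
abbrev MatSeq (d : ℕ) : Type := ℤ → Matrix (Fin (d + 1)) (Fin (d + 1)) ℝ

/-- A mask: a finitely supported matrix sequence. -/
def IsMask {d : ℕ} (A : MatSeq d) : Prop :=
  (Function.support A).Finite

/-- The subdivision operator `(S_A c)(α) = ∑_β A(α - 2β) c(β)`; the sum is finite for a mask. -/
noncomputable def subdivOp {d : ℕ} (A : MatSeq d) (c : VecSeq d) : VecSeq d :=
  fun α => ∑ᶠ β : ℤ, (A (α - 2 * β)).mulVec (c β)

/-- The symbol `A^*(z) = ∑_α A(α) z^α`, for `z ≠ 0`. -/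
noncomputable def symbol {d : ℕ} (A : MatSeq d) (z : ℂ) : Matrix (Fin (d + 1)) (Fin (d + 1)) ℂ :=
  ∑ᶠ α : ℤ, z ^ α • (A α).map (fun x : ℝ => (x : ℂ))

/-- `S_B` is contractive: some power of `S_B` has norm less than one as an operator on the bounded
vector sequences with the supremum norm. -/
def IsContractive {d : ℕ} (B : MatSeq d) : Prop :=
  ∃ n : ℕ, ∃ ρ : ℝ, ρ < 1 ∧ ∀ (c : VecSeq d) (M : ℝ), (∀ α i, |c α i| ≤ M) →
    ∀ α i, |((subdivOp B)^[n] c) α i| ≤ ρ * M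

/-- The coefficient matrix `t` of a generalized complete Taylor operator: `-1` on the first
superdiagonal, zero on and below the diagonal, arbitrary elsewhere. -/
def IsTaylorCoeff {d : ℕ} (t : Matrix (Fin (d + 1)) (Fin (d + 1)) ℝ) : Prop :=
  (∀ j k : Fin (d + 1), k ≤ j → t j k = 0) ∧
  (∀ j k : Fin (d + 1), (k : ℕ) = (j : ℕ) + 1 → t j k = -1)

/-- The operator `Δ I + t` on vector sequences, with `Δ c (α) = c (α + 1) - c (α)`. -/
def taylorOp {d : ℕ} (t : Matrix (Fin (d + 1)) (Fin (d + 1)) ℝ) (c : VecSeq d) : VecSeq d :=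
  fun α => (c (α + 1) - c α) + t.mulVec (c α)

/-- The diagonal matrix `D = diag (1, 1/2, …, 1/2^d)`. -/
noncomputable def hermiteD (d : ℕ) : Matrix (Fin (d + 1)) (Fin (d + 1)) ℝ :=
  Matrix.diagonal fun k => (1 / 2 : ℝ) ^ (k : ℕ)

/-- The refinements of the Hermite scheme `H_A`: level `n` uses the mask `D^{-n-1} A(·) D^n`. -/
noncomputable def hermiteSeq {d : ℕ} (A : MatSeq d) (f₀ : VecSeq d) : ℕ → VecSeq d
  | 0 => f₀
  | n + 1 => subdivOp (fun α => (hermiteD d)⁻¹ ^ (n + 1) * A α * hermiteD d ^ n) (hermiteSeq A f₀ n)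

/-- `Φ` is continuous and is the limit, uniformly on compact sets, of the refinements of `f₀`. -/
def IsHermiteLimit {d : ℕ} (A : MatSeq d) (f₀ : VecSeq d) (Φ : ℝ → Fin (d + 1) → ℝ) : Prop :=
  Continuous Φ ∧ ∀ K : Set ℝ, IsCompact K → ∃ ε : ℕ → ℝ,
    Filter.Tendsto ε Filter.atTop (nhds 0) ∧
    ∀ (n : ℕ) (α : ℤ), (α : ℝ) / 2 ^ n ∈ K →
      ∀ i, |hermiteSeq A f₀ n α i - Φ ((α : ℝ) / 2 ^ n) i| ≤ ε n

/-- `C^p`-convergence (for `p ≥ d`) of the Hermite scheme `H_A`: every initial sequence has a limit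
`Φ = [φ_0, …, φ_d]`, with `φ_0` of class `C^p` and `φ_i` its `i`-th derivative. -/
def IsHermiteConvergent {d : ℕ} (p : ℕ) (A : MatSeq d) : Prop :=
  ∀ f₀ : VecSeq d, ∃ Φ : ℝ → Fin (d + 1) → ℝ, IsHermiteLimit A f₀ Φ ∧
    ContDiff ℝ p (fun x => Φ x 0) ∧
    ∀ i : Fin (d + 1), iteratedDeriv i (fun x => Φ x 0) = fun x => Φ x i

/-- The polynomial `q_j(z) = (z+1) h_j(z) + ∑_{k<j} t_{kj} (z-1)^{j-1-k} h_k(z)`. -/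
noncomputable def lastRowDefect {d : ℕ} (t : Matrix (Fin (d + 1)) (Fin (d + 1)) ℝ)
    (h : Fin (d + 1) → ℝ[X]) (j : Fin (d + 1)) : ℝ[X] :=
  (X + 1) * h j + ∑ k ∈ Finset.Iio j, C (t k j) * (X - 1) ^ ((j : ℕ) - 1 - (k : ℕ)) * h k

/-- `h` solves the linear system for the derivatives at `1` with given `h_d = g`: the polynomials
`h_j`, `j < d`, of degree at most `j + 1` (each one given by its derivatives of order at most
`j + 1` at `1`) satisfy `h_j(1) = 2^{d-j}` and the equations `q_j^{(r)}(1) = 0`, `1 ≤ r ≤ j ≤ d`. -/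
def IsLastRowSolution {d : ℕ} (t : Matrix (Fin (d + 1)) (Fin (d + 1)) ℝ) (g : ℝ[X])
    (h : Fin (d + 1) → ℝ[X]) : Prop :=
  h (Fin.last d) = g ∧
  (∀ j : Fin (d + 1), (j : ℕ) < d → (h j).natDegree ≤ (j : ℕ) + 1) ∧
  (∀ j : Fin (d + 1), (h j).eval 1 = 2 ^ (d - (j : ℕ))) ∧
  ∀ (j : Fin (d + 1)) (r : ℕ), 1 ≤ r → r ≤ (j : ℕ) →
    ((derivative^[r]) (lastRowDefect t h j)).eval 1 = 0

/-! Sequences form a module over polynomials in the shift, where upsampling turns `X` into `X²`.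
With `T = (X - 1) I + t`, the intertwining relation becomes the matrix identity `T A = 2^{-d} B
T(X²)`, which is solved by matrices of rank one.

Back substitution gives polynomials `p_i` with `p_i(1) = 1` such that the column `v_i = (X - 1)^i
p_i` satisfies `T v = (X - 1)^{d+1} e_d` (`taylorPoly_mul_taylorFactor`). Let `A = v rᵀ`, and let
`B` have the single nonzero row `b_j = (X - 1)^{d-j} h_j`. The identity reduces to `r_k = 2^{-d} q_k
/ (X - 1)^k`; the system and the values `h_j(1)` supply this divisibility (`pow_dvd_lastRowDefect`).
The system itself is triangular, hence uniquely solvable.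

Take `h_d = (X + 1) / 2`. Multiplying the identity by `v(X²)` gives `rᵀ v(X²) = ((X + 1) / 2)^{d+1}
(X + 1)`, the B-spline symbol of degree `d + 1`. Hence `S_A^{n+1} c = v(E) S^n u` with `S` the
scalar spline scheme and `u` a scalar sequence depending on `c`. Differencing `i` times lowers the
spline degree by `i` and produces exactly the factor that the Hermite scaling removes, so component
`i` converges to the `i`-th derivative of a `C^d` spline. `B` is contractive because after one step
only the last component survives, and `(X + 1) / 2` halves its norm. -/

/-! ### Polynomials in the shift, upsampling and polynomial masks. -/

/-- The shift `(E u)(α) = u (α + 1)` on scalar sequences. -/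
def seqShift : Module.End ℝ (ℤ → ℝ) where
  toFun u := fun α => u (α + 1)
  map_add' _ _ := rfl
  map_smul' _ _ := rfl

/-- Upsampling: `c` on the even integers, zero on the odd ones. -/
noncomputable def upsample : (ℤ → ℝ) →ₗ[ℝ] (ℤ → ℝ) where
  toFun u := fun α => if Even α then u (α / 2) else 0
  map_add' u v := by ext α; by_cases h : Even α <;> simp [h]
  map_smul' a v := by ext α; by_cases h : Even α <;> simp [h]

/-- The coefficient sequence of a polynomial, extended by zero to the negative integers. -/
noncomputable def intCoeff (p : ℝ[X]) (k : ℤ) : ℝ :=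
  if 0 ≤ k then p.coeff k.toNat else 0

/-- The mask whose symbol is the polynomial matrix `P` evaluated at `z⁻¹`. -/
noncomputable def polyMask {d : ℕ} (P : Matrix (Fin (d + 1)) (Fin (d + 1)) ℝ[X]) : MatSeq d :=
  fun γ => Matrix.of fun i j => intCoeff (P i j) (-γ)

theorem seqShift_apply (u : ℤ → ℝ) (α : ℤ) : seqShift u α = u (α + 1) := rfl

theorem upsample_apply (u : ℤ → ℝ) (α : ℤ) :
    upsample u α = if Even α then u (α / 2) else 0 := rfl

theorem seqShift_pow_apply (k : ℕ) (u : ℤ → ℝ) (α : ℤ) : (seqShift ^ k) u α = u (α + k) := by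
  induction k generalizing α with
  | zero => simp
  | succ k ih =>
    rw [pow_succ', Module.End.mul_apply, seqShift_apply, ih]
    congr 1
    push_cast
    ring

theorem aeval_monomial_seqShift (k : ℕ) (a : ℝ) (u : ℤ → ℝ) (α : ℤ) :
    aeval seqShift (monomial k a) u α = a * u (α + k) := by
  rw [aeval_monomial, Module.End.mul_apply, Module.algebraMap_end_apply, Pi.smul_apply,
    seqShift_pow_apply, smul_eq_mul]

theorem aeval_seqShift_apply (p : ℝ[X]) (u : ℤ → ℝ) (α : ℤ) :
    aeval seqShift p u α = ∑ k ∈ Finset.range (p.natDegree + 1), p.coeff k * u (α + k) := by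
  conv_lhs => rw [p.as_sum_range]
  rw [map_sum, LinearMap.sum_apply, Finset.sum_apply]
  exact Finset.sum_congr rfl fun k _ => aeval_monomial_seqShift k _ u α

theorem aeval_mul_seqShift (p q : ℝ[X]) (u : ℤ → ℝ) :
    aeval seqShift (p * q) u = aeval seqShift p (aeval seqShift q u) := by
  rw [map_mul, Module.End.mul_apply]

theorem aeval_C_mul_seqShift (a : ℝ) (q : ℝ[X]) (u : ℤ → ℝ) :
    aeval seqShift (C a * q) u = a • aeval seqShift q u := by
  rw [aeval_mul_seqShift, aeval_C, Module.algebraMap_end_apply]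

theorem upsample_seqShift (u : ℤ → ℝ) :
    upsample (seqShift u) = seqShift (seqShift (upsample u)) := by
  ext α
  have h : (α + 1 + 1) / 2 = α / 2 + 1 := by omega
  simp only [upsample_apply, seqShift_apply, h]
  congr 1
  simp

/-- One shift before upsampling is two shifts after it. -/
theorem upsample_aeval (p : ℝ[X]) (u : ℤ → ℝ) :
    upsample (aeval seqShift p u) = aeval seqShift (expand ℝ 2 p) (upsample u) := by
  induction p using Polynomial.induction_on' with
  | add p q hp hq => simp only [map_add, LinearMap.add_apply, hp, hq]
  | monomial n a =>
    rw [← C_mul_X_pow_eq_monomial, map_mul (expand ℝ 2), expand_C, aeval_C_mul_seqShift, map_smul,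
      aeval_C_mul_seqShift]
    congr 1
    induction n with
    | zero => simp
    | succ n ih =>
      rw [pow_succ', map_mul (expand ℝ 2), aeval_mul_seqShift, aeval_mul_seqShift, expand_X, aeval_X,
        upsample_seqShift, ih, pow_two, aeval_mul_seqShift, aeval_X]

theorem abs_aeval_seqShift_le (p : ℝ[X]) (u : ℤ → ℝ) (α : ℤ) (M : ℝ)
    (h : ∀ β, α ≤ β → β ≤ α + p.natDegree → |u β| ≤ M) :
    |aeval seqShift p u α| ≤ (∑ k ∈ Finset.range (p.natDegree + 1), |p.coeff k|) * M := by
  rw [aeval_seqShift_apply, Finset.sum_mul]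
  refine (Finset.abs_sum_le_sum_abs _ _).trans (Finset.sum_le_sum fun k hk => ?_)
  rw [abs_mul]
  have hk' := Finset.mem_range.1 hk
  exact mul_le_mul_of_nonneg_left (h _ (by omega) (by omega)) (abs_nonneg _)

theorem finite_support_intCoeff (p : ℝ[X]) : (Function.support (intCoeff p)).Finite := by
  refine (p.support.finite_toSet.image fun k : ℕ => (k : ℤ)).subset fun k hk => ?_
  rw [Function.mem_support, intCoeff] at hk
  split_ifs at hk with h0
  · exact ⟨k.toNat, by simpa using hk, by simp [h0]⟩
  · exact absurd rfl hk

theorem intCoeff_add (p q : ℝ[X]) (k : ℤ) : intCoeff (p + q) k = intCoeff p k + intCoeff q k := by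
  unfold intCoeff
  split_ifs <;> simp

theorem intCoeff_monomial (n : ℕ) (a : ℝ) (k : ℤ) :
    intCoeff (monomial n a) k = if k = n then a else 0 := by
  unfold intCoeff
  rw [coeff_monomial]
  split_ifs <;> first | rfl | omega

theorem finite_support_intCoeff_mul (p : ℝ[X]) (c : ℤ → ℝ) (α : ℤ) :
    (Function.support fun β : ℤ => intCoeff p (-(α - 2 * β)) * c β).Finite := by
  refine ((finite_support_intCoeff p).preimage
    (f := fun β : ℤ => -(α - 2 * β)) ?_).subset fun β hβ => ?_
  · intro x _ y _ h
    simp only at h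
    omega
  · exact left_ne_zero_of_mul hβ

/-- For a monomial of exponent `n` only the index with `2β = α + n` contributes. This replaces
subdivision sums by polynomial algebra. -/
theorem aeval_seqShift_upsample (p : ℝ[X]) (c : ℤ → ℝ) (α : ℤ) :
    aeval seqShift p (upsample c) α = ∑ᶠ β : ℤ, intCoeff p (-(α - 2 * β)) * c β := by
  induction p using Polynomial.induction_on' with
  | add p q hp hq =>
    simp only [intCoeff_add, add_mul]
    rw [finsum_add_distrib (finite_support_intCoeff_mul p c α) (finite_support_intCoeff_mul q c α),
      ← hp, ← hq, map_add]
    rfl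
  | monomial n a =>
    rw [aeval_monomial_seqShift, upsample_apply]
    simp only [intCoeff_monomial]
    rw [finsum_eq_single _ ((α + n) / 2)]
    · split_ifs with h1 h2 h2
      · rfl
      · obtain ⟨r, hr⟩ := h1
        omega
      · exact absurd ⟨(α + n) / 2, by omega⟩ h1
      · simp
    · intro β hβ
      rw [if_neg (by omega), zero_mul]

theorem isMask_polyMask {d : ℕ} (P : Matrix (Fin (d + 1)) (Fin (d + 1)) ℝ[X]) :
    IsMask (polyMask P) := by
  refine (Set.finite_iUnion fun i => Set.finite_iUnion fun j =>
    (finite_support_intCoeff (P i j)).image (fun k => -k)).subset fun γ hγ => ?_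
  by_contra hcon
  refine hγ (Matrix.ext fun i j => ?_)
  by_contra hne
  exact hcon (Set.mem_iUnion.2 ⟨i, Set.mem_iUnion.2 ⟨j, -γ, hne, neg_neg γ⟩⟩)

theorem subdivOp_polyMask {d : ℕ} (P : Matrix (Fin (d + 1)) (Fin (d + 1)) ℝ[X]) (c : VecSeq d)
    (α : ℤ) (i : Fin (d + 1)) :
    subdivOp (polyMask P) c α i
      = ∑ j, aeval seqShift (P i j) (upsample fun β => c β j) α := by
  have hfin : (Function.support fun β : ℤ => (polyMask P (α - 2 * β)).mulVec (c β)).Finite := by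
    refine ((isMask_polyMask P).preimage
      (f := fun β : ℤ => α - 2 * β) ?_).subset fun β hβ => ?_
    · intro x _ y _ h
      simp only at h
      omega
    · intro h0
      exact hβ (by simp only [h0, Matrix.zero_mulVec])
  have h := (Pi.evalAddMonoidHom (fun _ : Fin (d + 1) => ℝ) i).map_finsum hfin
  simp only [Pi.evalAddMonoidHom_apply] at h
  rw [subdivOp, h]
  simp only [aeval_seqShift_upsample]
  rw [← finsum_sum_comm _ _ fun j _ => finite_support_intCoeff_mul (P i j) _ α]
  rfl

theorem finsum_intCoeff (p : ℝ[X]) (z : ℂ) :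
    ∑ᶠ α : ℤ, z ^ α * (intCoeff p (-α) : ℂ) = aeval z⁻¹ p := by
  have hfin : ∀ q : ℝ[X], (Function.support fun α : ℤ => z ^ α * (intCoeff q (-α) : ℂ)).Finite := by
    intro q
    refine ((finite_support_intCoeff q).image fun k => -k).subset fun α hα => ⟨-α, ?_, neg_neg α⟩
    intro h
    exact hα (by simp only [h]; simp)
  induction p using Polynomial.induction_on' with
  | add p q hp hq =>
    simp only [intCoeff_add, Complex.ofReal_add, mul_add]
    rw [finsum_add_distrib (hfin p) (hfin q), hp, hq, map_add]
  | monomial n a =>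
    rw [finsum_eq_single _ (-(n : ℤ)), intCoeff_monomial, aeval_monomial]
    · simp [mul_comm]
    · intro α hα
      rw [intCoeff_monomial, if_neg (by omega)]
      simp

theorem symbol_polyMask {d : ℕ} (P : Matrix (Fin (d + 1)) (Fin (d + 1)) ℝ[X]) (z : ℂ)
    (i j : Fin (d + 1)) : symbol (polyMask P) z i j = aeval z⁻¹ (P i j) := by
  have hfin : (Function.support fun α : ℤ =>
      z ^ α • (polyMask P α).map (fun x : ℝ => (x : ℂ))).Finite := by
    refine (isMask_polyMask P).subset fun α hα h0 => hα ?_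
    simp only [h0]
    ext
    simp
  have h := (Matrix.entryAddMonoidHom ℂ i j).map_finsum hfin
  rw [← finsum_intCoeff]
  exact h

/-! ### The Taylor operator and the intertwining relation on symbols. -/

/-- The symbol of the operator `Δ I + t`, as a polynomial matrix in `z⁻¹`. -/
noncomputable def taylorPoly {d : ℕ} (t : Matrix (Fin (d + 1)) (Fin (d + 1)) ℝ) :
    Matrix (Fin (d + 1)) (Fin (d + 1)) ℝ[X] :=
  Matrix.of fun j k => (if j = k then X - 1 else 0) + C (t j k)

theorem taylorPoly_apply {d : ℕ} (t : Matrix (Fin (d + 1)) (Fin (d + 1)) ℝ) (j k : Fin (d + 1)) :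
    taylorPoly t j k = (if j = k then X - 1 else 0) + C (t j k) := rfl

theorem taylorOp_apply {d : ℕ} (t : Matrix (Fin (d + 1)) (Fin (d + 1)) ℝ) (c : VecSeq d) (α : ℤ)
    (i : Fin (d + 1)) :
    taylorOp t c α i = ∑ j, aeval seqShift (taylorPoly t i j) (fun β => c β j) α := by
  simp only [taylorPoly_apply, map_add, LinearMap.add_apply, Pi.add_apply, Finset.sum_add_distrib,
    taylorOp, Matrix.mulVec, dotProduct, aeval_C, Module.algebraMap_end_apply, Pi.smul_apply,
    smul_eq_mul]
  congr 1
  rw [Finset.sum_eq_single i]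
  · simp [seqShift_apply]
  · intro j _ hj
    simp [hj.symm]
  · simp

/-- An identity `T A = a B T(X²)` of polynomial matrices yields the operator identity
`(Δ I + t) S_A = a S_B (Δ I + t)`. -/
theorem taylorOp_subdivOp {d : ℕ} (t : Matrix (Fin (d + 1)) (Fin (d + 1)) ℝ) (a : ℝ)
    (P Q : Matrix (Fin (d + 1)) (Fin (d + 1)) ℝ[X])
    (h : ∀ i k, ∑ j, taylorPoly t i j * P j k
      = C a * ∑ j, Q i j * expand ℝ 2 (taylorPoly t j k))
    (c : VecSeq d) :
    taylorOp t (subdivOp (polyMask P) c) = a • subdivOp (polyMask Q) (taylorOp t c) := by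
  ext α i
  have h1 : ∀ j, (fun β => subdivOp (polyMask P) c β j)
      = ∑ k, aeval seqShift (P j k) (upsample fun β => c β k) := by
    intro j
    ext β
    rw [subdivOp_polyMask, Finset.sum_apply]
  have h2 : ∀ j, (fun β => taylorOp t c β j) = ∑ k, aeval seqShift (taylorPoly t j k) (fun β => c β k) := by
    intro j
    ext β
    rw [taylorOp_apply, Finset.sum_apply]
  rw [taylorOp_apply, Pi.smul_apply, Pi.smul_apply, subdivOp_polyMask]
  simp only [h1, h2, map_sum, upsample_aeval, ← aeval_mul_seqShift, Finset.sum_apply]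
  have h3 : ∀ f : Fin (d + 1) → Fin (d + 1) → ℝ[X],
      ∑ j, ∑ k, aeval seqShift (f j k) (upsample fun β => c β k) α
        = ∑ k, aeval seqShift (∑ j, f j k) (upsample fun β => c β k) α := by
    intro f
    rw [Finset.sum_comm]
    simp only [map_sum, LinearMap.sum_apply, Finset.sum_apply]
  rw [h3, h3, Finset.smul_sum]
  refine Finset.sum_congr rfl fun k _ => ?_
  rw [h, aeval_C_mul_seqShift]
  rfl

/-! ### B-spline subdivision and its limit functions. -/

/-- The difference operator as an operator on scalar sequences. -/
noncomputable def seqDiff : Module.End ℝ (ℤ → ℝ) := aeval seqShift (X - 1 : ℝ[X])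

/-- The symbol `(X + 1) ((X + 1) / 2) ^ m` of the B-spline scheme of degree `m`. -/
noncomputable def splineSymbol (m : ℕ) : ℝ[X] := (C (1 / 2) * (X + 1)) ^ m * (X + 1)

/-- The B-spline subdivision operator of degree `m`. -/
noncomputable def splineOp (m : ℕ) (u : ℤ → ℝ) : ℤ → ℝ :=
  aeval seqShift (splineSymbol m) (upsample u)

/-- The spline of degree `m` with coefficients `u`. -/
noncomputable def splineFun : ℕ → (ℤ → ℝ) → ℝ → ℝ
  | 0, u => fun x => u ⌈x⌉
  | m + 1, u => fun x => ∫ y in x..x + 1, splineFun m u y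

theorem seqDiff_apply (u : ℤ → ℝ) (α : ℤ) : seqDiff u α = u (α + 1) - u α := by
  simp [seqDiff, seqShift_apply]

theorem splineOp_zero_apply (u : ℤ → ℝ) (α : ℤ) : splineOp 0 u α = u ((α + 1) / 2) := by
  simp only [splineOp, splineSymbol, pow_zero, one_mul, map_add, aeval_X, map_one,
    LinearMap.add_apply, Module.End.one_apply, Pi.add_apply, seqShift_apply, upsample_apply]
  by_cases h : Even α
  · rw [if_neg (by rwa [Int.even_add_one, not_not]), if_pos h, zero_add]
    congr 1
    obtain ⟨r, hr⟩ := h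
    omega
  · rw [if_pos (by rwa [Int.even_add_one]), if_neg h, add_zero]

theorem splineOp_succ (m : ℕ) (u : ℤ → ℝ) :
    splineOp (m + 1) u = (1 / 2 : ℝ) • (splineOp m u + seqShift (splineOp m u)) := by
  have h : splineSymbol (m + 1) = C (1 / 2) * ((X + 1) * splineSymbol m) := by
    unfold splineSymbol
    ring
  rw [splineOp, h, aeval_C_mul_seqShift, aeval_mul_seqShift, map_add, aeval_X, map_one,
    LinearMap.add_apply, Module.End.one_apply, add_comm]
  rfl

theorem splineOp_smul (m : ℕ) (a : ℝ) (u : ℤ → ℝ) : splineOp m (a • u) = a • splineOp m u := by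
  simp only [splineOp, map_smul]

/-- One factor `(X + 1) / 2` of the symbol combines with `X - 1` into `(X² - 1) / 2`, which passes
through upsampling as a difference. -/
theorem seqDiff_splineOp (m : ℕ) (u : ℤ → ℝ) :
    seqDiff (splineOp (m + 1) u) = (1 / 2 : ℝ) • splineOp m (seqDiff u) := by
  have h : (X - 1) * splineSymbol (m + 1)
      = C (1 / 2) * (splineSymbol m * expand ℝ 2 (X - 1)) := by
    unfold splineSymbol
    rw [map_sub, expand_X, map_one]
    ring
  rw [splineOp, seqDiff, ← aeval_mul_seqShift, h, aeval_C_mul_seqShift, aeval_mul_seqShift,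
    ← upsample_aeval]
  rfl

theorem seqDiff_splineOp_iterate (m n : ℕ) (u : ℤ → ℝ) :
    seqDiff ((splineOp (m + 1))^[n] u)
      = (1 / 2 : ℝ) ^ n • (splineOp m)^[n] (seqDiff u) := by
  induction n with
  | zero => simp
  | succ n ih =>
    rw [Function.iterate_succ_apply', seqDiff_splineOp, ih, splineOp_smul, smul_smul,
      Function.iterate_succ_apply', pow_succ']

theorem seqDiff_pow_splineOp_iterate (m n i : ℕ) (u : ℤ → ℝ) :
    (seqDiff ^ i) ((splineOp (m + i))^[n] u)
      = ((1 / 2 : ℝ) ^ n) ^ i • (splineOp m)^[n] ((seqDiff ^ i) u) := by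
  induction i generalizing u with
  | zero => simp
  | succ i ih =>
    rw [pow_succ, Module.End.mul_apply, ← add_assoc, seqDiff_splineOp_iterate, map_smul, ih,
      smul_smul, ← pow_succ', Module.End.mul_apply]

/-- Degree zero only copies values, and each further degree averages two neighbours. -/
theorem abs_splineOp_le (m : ℕ) (u : ℤ → ℝ) (M : ℝ) (α : ℤ)
    (h : ∀ β : ℤ, α ≤ 2 * β → 2 * β ≤ α + m + 1 → |u β| ≤ M) : |splineOp m u α| ≤ M := by
  induction m generalizing α with
  | zero =>
    rw [splineOp_zero_apply]
    exact h _ (by omega) (by push_cast; omega)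
  | succ m ih =>
    have h1 := ih α fun β h1 h2 => h β h1 (by push_cast; omega)
    have h2 := ih (α + 1) fun β h1 h2 => h β (by omega) (by push_cast; omega)
    rw [splineOp_succ, Pi.smul_apply, Pi.add_apply, seqShift_apply, smul_eq_mul]
    rw [abs_le] at h1 h2 ⊢
    constructor <;> linarith [h1.1, h1.2, h2.1, h2.2]

/-- A margin `W ≥ m + 1` is stable: going one level down halves `2^{n+1} R + W + m + 1`, giving at
most `2^n R + W`. -/
theorem abs_splineOp_iterate_le (m n : ℕ) (u : ℤ → ℝ) (M R W : ℝ) (hW : m + 1 ≤ W)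
    (h : ∀ β : ℤ, |(β : ℝ)| ≤ R + W → |u β| ≤ M) (α : ℤ) (hα : |(α : ℝ)| ≤ 2 ^ n * R + W) :
    |((splineOp m)^[n] u) α| ≤ M := by
  induction n generalizing α with
  | zero => exact h α (by simpa using hα)
  | succ n ih =>
    rw [Function.iterate_succ_apply']
    refine abs_splineOp_le m _ M α fun β h1 h2 => ih β ?_
    have h1' : (α : ℝ) ≤ 2 * β := by exact_mod_cast h1
    have h2' : (2 * β : ℝ) ≤ α + m + 1 := by exact_mod_cast h2
    rw [pow_succ] at hα
    rw [abs_le] at hα ⊢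
    constructor <;> linarith [hα.1, hα.2, (Nat.cast_nonneg m : (0 : ℝ) ≤ m)]

theorem exists_abs_le_of_abs_le (u : ℤ → ℝ) (R : ℝ) :
    ∃ M : ℝ, 0 ≤ M ∧ ∀ β : ℤ, |(β : ℝ)| ≤ R → |u β| ≤ M := by
  refine ⟨∑ β ∈ Finset.Icc (-⌈R⌉) ⌈R⌉, |u β|, Finset.sum_nonneg fun _ _ => abs_nonneg _,
    fun β hβ => ?_⟩
  refine Finset.single_le_sum (f := fun β => |u β|) (fun _ _ => abs_nonneg _) ?_
  rw [abs_le] at hβ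
  have h1 := Int.le_ceil R
  rw [Finset.mem_Icc]
  constructor
  · have : ((-⌈R⌉ : ℤ) : ℝ) ≤ β := by push_cast; linarith [hβ.1]
    exact_mod_cast this
  · have : (β : ℝ) ≤ (⌈R⌉ : ℤ) := by linarith [hβ.2]
    exact_mod_cast this

theorem intervalIntegrable_comp_ceil (u : ℤ → ℝ) (a b : ℝ) :
    IntervalIntegrable (fun x : ℝ => u ⌈x⌉) MeasureTheory.volume a b := by
  obtain ⟨M, hM0, hM⟩ := exists_abs_le_of_abs_le u (|a| + |b| + 1)
  have hmeas : Measurable fun x : ℝ => u ⌈x⌉ :=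
    (measurable_from_top (f := u)).comp Int.measurable_ceil
  refine IntervalIntegrable.mono_fun (f := fun _ => M)
    intervalIntegrable_const hmeas.aestronglyMeasurable ?_
  refine (MeasureTheory.ae_restrict_iff' measurableSet_uIoc).2 (Filter.Eventually.of_forall ?_)
  intro x hx
  change |u ⌈x⌉| ≤ |M|
  rw [abs_of_nonneg hM0]
  apply hM
  have h1 := Int.le_ceil x
  have h2 := Int.ceil_lt_add_one x
  have hx' : |x| ≤ |a| + |b| := by
    have h3 := neg_abs_le a
    have h4 := neg_abs_le b
    have h5 := le_abs_self a
    have h6 := le_abs_self b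
    rw [abs_le]
    rcases Set.mem_uIoc.1 hx with h | h <;> constructor <;>
      linarith [h.1, h.2, abs_nonneg a, abs_nonneg b]
  rw [abs_le] at hx' ⊢
  constructor <;> linarith [hx'.1, hx'.2]

theorem continuous_integral_unit {f : ℝ → ℝ}
    (hf : ∀ a b, IntervalIntegrable f MeasureTheory.volume a b) :
    Continuous fun x => ∫ y in x..x + 1, f y := by
  have h : (fun x => ∫ y in x..x + 1, f y)
      = fun x => (∫ y in (0 : ℝ)..x + 1, f y) - ∫ y in (0 : ℝ)..x, f y := by
    ext x
    rw [intervalIntegral.integral_interval_sub_left (hf _ _) (hf _ _)]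
  rw [h]
  have hc := intervalIntegral.continuous_primitive hf 0
  exact (hc.comp (continuous_id.add continuous_const)).sub hc

theorem intervalIntegrable_splineFun (m : ℕ) (u : ℤ → ℝ) (a b : ℝ) :
    IntervalIntegrable (splineFun m u) MeasureTheory.volume a b := by
  induction m generalizing a b with
  | zero => exact intervalIntegrable_comp_ceil u a b
  | succ m ih => exact (continuous_integral_unit ih).intervalIntegrable a b

theorem continuous_splineFun_succ (m : ℕ) (u : ℤ → ℝ) : Continuous (splineFun (m + 1) u) :=
  continuous_integral_unit (intervalIntegrable_splineFun m u)

theorem splineFun_add (m : ℕ) (u v : ℤ → ℝ) (x : ℝ) :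
    splineFun m (u + v) x = splineFun m u x + splineFun m v x := by
  induction m generalizing x with
  | zero => rfl
  | succ m ih =>
    simp only [splineFun, ih]
    exact intervalIntegral.integral_add (intervalIntegrable_splineFun m u _ _)
      (intervalIntegrable_splineFun m v _ _)

theorem splineFun_smul (m : ℕ) (a : ℝ) (u : ℤ → ℝ) (x : ℝ) :
    splineFun m (a • u) x = a * splineFun m u x := by
  induction m generalizing x with
  | zero => rfl
  | succ m ih =>
    simp only [splineFun, ih]
    exact intervalIntegral.integral_const_mul _ _

theorem splineFun_seqShift (m : ℕ) (u : ℤ → ℝ) (x : ℝ) :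
    splineFun m (seqShift u) x = splineFun m u (x + 1) := by
  induction m generalizing x with
  | zero => simp only [splineFun, seqShift_apply, Int.ceil_add_one]
  | succ m ih =>
    simp only [splineFun, ih]
    exact intervalIntegral.integral_comp_add_right (splineFun m u) 1

theorem splineFun_seqDiff (m : ℕ) (u : ℤ → ℝ) (x : ℝ) :
    splineFun m (seqDiff u) x = splineFun m u (x + 1) - splineFun m u x := by
  have h : seqDiff u = seqShift u + (-1 : ℝ) • u := by
    ext α
    simp [seqDiff_apply, seqShift_apply, sub_eq_add_neg]
  rw [h, splineFun_add, splineFun_smul, splineFun_seqShift]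
  ring

theorem hasDerivAt_splineFun (m : ℕ) (u : ℤ → ℝ) (x : ℝ) :
    HasDerivAt (splineFun (m + 2) u) (splineFun (m + 1) (seqDiff u) x) x := by
  have hc := continuous_splineFun_succ m u
  have hi := intervalIntegrable_splineFun (m + 1) u
  have h : splineFun (m + 2) u = fun x => (∫ y in (0 : ℝ)..x + 1, splineFun (m + 1) u y)
      - ∫ y in (0 : ℝ)..x, splineFun (m + 1) u y := by
    ext x
    rw [intervalIntegral.integral_interval_sub_left (hi _ _) (hi _ _)]
    rfl
  have hd : ∀ z, HasDerivAt (fun x => ∫ y in (0 : ℝ)..x, splineFun (m + 1) u y)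
      (splineFun (m + 1) u z) z := fun z =>
    intervalIntegral.integral_hasDerivAt_right (hi _ _)
      (hc.stronglyMeasurableAtFilter _ _) hc.continuousAt
  rw [h, splineFun_seqDiff]
  exact ((hd (x + 1)).comp_add_const x 1).sub (hd x)

/-- The refinement equation. In degree zero it says that `⌈x⌉` is `⌈2x⌉ / 2` rounded up. In the
inductive step two adjacent unit integrals merge into one over `[2x, 2x + 2]`, and the substitution
factor `2` cancels the mask factor `1 / 2`. -/
theorem splineFun_splineOp (m : ℕ) (u : ℤ → ℝ) (x : ℝ) :
    splineFun m (splineOp m u) (2 * x) = splineFun m u x := by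
  induction m generalizing x with
  | zero =>
    simp only [splineFun, splineOp_zero_apply]
    congr 1
    apply le_antisymm
    · have h1 : ⌈2 * x⌉ ≤ 2 * ⌈x⌉ := by
        rw [Int.ceil_le]
        push_cast
        linarith [Int.le_ceil x]
      omega
    · rw [Int.ceil_le]
      have h1 : ⌈2 * x⌉ ≤ 2 * ((⌈2 * x⌉ + 1) / 2) := by omega
      have h2 : ((⌈2 * x⌉ : ℤ) : ℝ) ≤ 2 * (((⌈2 * x⌉ + 1) / 2 : ℤ) : ℝ) := by exact_mod_cast h1
      linarith [Int.le_ceil (2 * x)]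
  | succ m ih =>
    have hi := intervalIntegrable_splineFun m (splineOp m u)
    rw [splineOp_succ, splineFun_smul, splineFun_add, splineFun_seqShift]
    simp only [splineFun]
    rw [intervalIntegral.integral_add_adjacent_intervals (hi _ _) (hi _ _)]
    have h := intervalIntegral.mul_integral_comp_mul_left (f := splineFun m (splineOp m u))
      (a := x) (b := x + 1) (c := 2)
    simp only [ih] at h
    rw [show 2 * x + 1 + 1 = 2 * (x + 1) by ring, ← h]
    ring

theorem splineFun_splineOp_iterate (m n : ℕ) (u : ℤ → ℝ) (x : ℝ) :
    splineFun m ((splineOp m)^[n] u) (2 ^ n * x) = splineFun m u x := by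
  induction n generalizing x with
  | zero => simp
  | succ n ih =>
    rw [Function.iterate_succ_apply', pow_succ', mul_assoc, splineFun_splineOp, ih]

/-- A spline value is an iterated average of the coefficients in a window of length `m + 1`. -/
theorem abs_splineFun_sub_le (m : ℕ) (u : ℤ → ℝ) (c M x : ℝ)
    (h : ∀ β : ℤ, x ≤ β → β ≤ x + m + 1 → |u β - c| ≤ M) : |splineFun m u x - c| ≤ M := by
  induction m generalizing x with
  | zero =>
    exact h _ (Int.le_ceil x) (by push_cast; linarith [Int.ceil_lt_add_one x])
  | succ m ih =>
    have hi := intervalIntegrable_splineFun m u x (x + 1)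
    have h1 : splineFun (m + 1) u x - c = ∫ y in x..x + 1, (splineFun m u y - c) := by
      rw [intervalIntegral.integral_sub hi intervalIntegrable_const]
      simp [splineFun]
    rw [h1]
    have h2 := intervalIntegral.norm_integral_le_of_norm_le_const (a := x) (b := x + 1) (C := M)
      (f := fun y => splineFun m u y - c) ?_
    · simpa using h2
    · intro y hy
      rw [Set.uIoc_of_le (by linarith)] at hy
      exact ih y fun β hb1 hb2 => h β (by linarith [hy.1]) (by push_cast; linarith [hy.2])

theorem abs_sub_le_of_seqDiff (u : ℤ → ℝ) (α : ℤ) (M : ℝ) (k : ℕ)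
    (h : ∀ β : ℤ, α ≤ β → β < α + k → |seqDiff u β| ≤ M) : |u (α + k) - u α| ≤ k * M := by
  induction k with
  | zero => simp
  | succ k ih =>
    have h1 := ih fun β h1 h2 => h β h1 (by push_cast; omega)
    have h2 := h (α + k) (by omega) (by push_cast; omega)
    rw [seqDiff_apply] at h2
    push_cast
    rw [← add_assoc]
    have h3 := abs_sub_le (u (α + k + 1)) (u (α + k)) (u α)
    linarith

/-- If `p (1) = 1`, then `p` of the shift, applied to the refinements of `u`, approximates the
spline with coefficients `u` at the rate `2⁻ⁿ` on bounded sets. -/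
theorem exists_abs_aeval_splineOp_iterate_sub_le (m : ℕ) (p : ℝ[X]) (hp : p.eval 1 = 1)
    (u : ℤ → ℝ) (R : ℝ) :
    ∃ K : ℝ, ∀ (n : ℕ) (α : ℤ), |(α : ℝ)| ≤ 2 ^ n * R →
      |aeval seqShift p ((splineOp (m + 1))^[n] u) α - splineFun (m + 1) u (α / 2 ^ n)|
        ≤ K * (1 / 2) ^ n := by
  obtain ⟨q, hq⟩ : X - C 1 ∣ p - 1 := dvd_iff_isRoot.2 (by simp [hp])
  have hpq : p = 1 + q * (X - 1) := by
    rw [mul_comm, ← C_1, ← hq, C_1]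
    ring
  -- The margin covers both the support of `q` and the averaging window of the spline of degree `m +
  -- 1`.
  set W : ℝ := m + 2 + q.natDegree with hW
  obtain ⟨M, hM0, hM⟩ := exists_abs_le_of_abs_le (seqDiff u) (R + W)
  set K := ∑ k ∈ Finset.range (q.natDegree + 1), |q.coeff k| with hK
  refine ⟨K * M + (m + 2) * M, fun n α hα => ?_⟩
  set y := (splineOp (m + 1))^[n] u with hy
  have hdiff : ∀ β : ℤ, |(β : ℝ)| ≤ 2 ^ n * R + W → |seqDiff y β| ≤ M * (1 / 2) ^ n := by
    intro β hβ
    rw [hy, seqDiff_splineOp_iterate, Pi.smul_apply, smul_eq_mul, abs_mul,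
      abs_of_nonneg (by positivity : (0 : ℝ) ≤ (1 / 2) ^ n), mul_comm]
    refine mul_le_mul_of_nonneg_right ?_ (by positivity)
    refine abs_splineOp_iterate_le m n _ M R W ?_ hM β hβ
    have : (0 : ℝ) ≤ q.natDegree := Nat.cast_nonneg _
    linarith
  have hwin : ∀ (β : ℤ) (k : ℕ), (k : ℝ) ≤ W → α ≤ β → β ≤ α + k →
      |seqDiff y β| ≤ M * (1 / 2) ^ n := by
    intro β k hk h1 h2
    apply hdiff
    have h1' : (α : ℝ) ≤ β := by exact_mod_cast h1
    have h2' : (β : ℝ) ≤ α + k := by exact_mod_cast h2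
    rw [abs_le] at hα ⊢
    constructor <;> linarith [hα.1, hα.2, (Nat.cast_nonneg k : (0 : ℝ) ≤ k)]
  have h1 : |aeval seqShift p y α - y α| ≤ K * (M * (1 / 2) ^ n) := by
    rw [hpq, map_add, map_one, LinearMap.add_apply, Pi.add_apply, Module.End.one_apply,
      add_sub_cancel_left, aeval_mul_seqShift]
    exact abs_aeval_seqShift_le q _ α _ fun β h1 h2 =>
      hwin β q.natDegree (by rw [hW]; linarith [(Nat.cast_nonneg m : (0 : ℝ) ≤ m)]) h1 h2
  -- By the refinement equation the limit is also the spline with coefficients `y`, evaluated at the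
  -- integer `α`.
  have h2 : |splineFun (m + 1) u (α / 2 ^ n) - y α| ≤ (m + 2) * (M * (1 / 2) ^ n) := by
    rw [← splineFun_splineOp_iterate (m + 1) n, mul_div_cancel₀ _ (by positivity), ← hy]
    refine abs_splineFun_sub_le _ _ _ _ _ fun β hb1 hb2 => ?_
    have hb1' : α ≤ β := by exact_mod_cast hb1
    have hb2' : β ≤ α + (m + 2 : ℕ) := by
      have : (β : ℝ) ≤ ((α + (m + 2 : ℕ) : ℤ) : ℝ) := by push_cast at hb2 ⊢; linarith
      exact_mod_cast this
    obtain ⟨k, hk⟩ := Int.eq_ofNat_of_zero_le (sub_nonneg.2 hb1')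
    obtain rfl : β = α + k := by omega
    have hk2 : k ≤ m + 2 := by omega
    have hk3 : (k : ℝ) ≤ m + 2 := by exact_mod_cast hk2
    refine (abs_sub_le_of_seqDiff y α (M * (1 / 2) ^ n) k fun γ h3 h4 =>
      hwin γ (m + 2) ?_ h3 (by push_cast; omega)).trans ?_
    · push_cast
      rw [hW]
      linarith [(Nat.cast_nonneg q.natDegree : (0 : ℝ) ≤ _)]
    · exact mul_le_mul_of_nonneg_right hk3 (by positivity)
  have h3 := abs_sub_le (aeval seqShift p y α) (y α) (splineFun (m + 1) u (α / 2 ^ n))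
  rw [abs_sub_comm (y α)] at h3
  calc _ ≤ _ := h3
    _ ≤ K * (M * (1 / 2) ^ n) + (m + 2) * (M * (1 / 2) ^ n) := add_le_add h1 h2
    _ = _ := by ring

/-! ### The triangular linear system for the last row. -/

theorem iterate_derivative_eval_one (p : ℝ[X]) (r : ℕ) :
    ((derivative^[r]) p).eval 1 = (r.factorial : ℝ) * (taylor 1 p).coeff r := by
  rw [taylor_coeff, ← factorial_smul_hasseDeriv, LinearMap.smul_apply, eval_smul, nsmul_eq_mul]

theorem taylor_lastRowDefect_coeff {d : ℕ} (t : Matrix (Fin (d + 1)) (Fin (d + 1)) ℝ)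
    (h : Fin (d + 1) → ℝ[X]) (j : Fin (d + 1)) (r : ℕ) (hr : 1 ≤ r) :
    (taylor 1 (lastRowDefect t h j)).coeff r
      = 2 * (taylor 1 (h j)).coeff r + (taylor 1 (h j)).coeff (r - 1)
        + ∑ k ∈ Finset.Iio j, t k j * (if (j : ℕ) - 1 - k ≤ r then
            (taylor 1 (h k)).coeff (r - ((j : ℕ) - 1 - k)) else 0) := by
  obtain ⟨s, rfl⟩ := Nat.exists_eq_add_of_le' hr
  have h1 : taylor 1 (X + 1 : ℝ[X]) = X + C 2 := by
    rw [map_add, taylor_X, taylor_one, add_assoc, ← C_add]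
    norm_num
  have h2 : taylor 1 (X - 1 : ℝ[X]) = X := by
    rw [map_sub, taylor_X, taylor_one]
    simp
  rw [lastRowDefect, map_add, taylor_mul, h1, coeff_add, add_mul, coeff_add, coeff_X_mul,
    coeff_C_mul, map_sum, finsetSum_coeff, Nat.add_sub_cancel]
  congr 1
  · ring
  · refine Finset.sum_congr rfl fun k _ => ?_
    rw [taylor_mul, taylor_mul, taylor_C, taylor_pow, h2, mul_assoc, coeff_C_mul, coeff_X_pow_mul']

/-- The solution of the linear system: Taylor coefficients at `1` of the polynomials `h_j`. -/
noncomputable def lastRowCoeff {d : ℕ} (t : Matrix (Fin (d + 1)) (Fin (d + 1)) ℝ) (g : ℝ[X])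
    (r : ℕ) (j : Fin (d + 1)) : ℝ :=
  if hj : (j : ℕ) < d then
    if hr : r = 0 then 2 ^ (d - (j : ℕ))
    else
      let j' : Fin (d + 1) := ⟨j + 1, by omega⟩
      2 * lastRowCoeff t g r j' + lastRowCoeff t g (r - 1) j'
        + ∑ k : Fin (d + 1), if h : (k : ℕ) < j ∧ (j : ℕ) - k ≤ r then
            t k j' * lastRowCoeff t g (r - ((j : ℕ) - k)) k else 0
  else (taylor 1 g).coeff r
-- The first term keeps the order `r` and raises the index; all others lower the order.
termination_by (r, d - (j : ℕ))
decreasing_by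
  · exact Prod.Lex.right _ (by omega)
  · exact Prod.Lex.left _ _ (by omega)
  · exact Prod.Lex.left _ _ (by omega)

theorem lastRowCoeff_of_not_lt {d : ℕ} (t : Matrix (Fin (d + 1)) (Fin (d + 1)) ℝ) (g : ℝ[X])
    (r : ℕ) (j : Fin (d + 1)) (hj : ¬ (j : ℕ) < d) :
    lastRowCoeff t g r j = (taylor 1 g).coeff r := by
  rw [lastRowCoeff, dif_neg hj]

theorem lastRowCoeff_zero {d : ℕ} (t : Matrix (Fin (d + 1)) (Fin (d + 1)) ℝ) (g : ℝ[X])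
    (j : Fin (d + 1)) (hj : (j : ℕ) < d) :
    lastRowCoeff t g 0 j = 2 ^ (d - (j : ℕ)) := by
  rw [lastRowCoeff, dif_pos hj, dif_pos rfl]

theorem lastRowCoeff_of_ne_zero {d : ℕ} (t : Matrix (Fin (d + 1)) (Fin (d + 1)) ℝ) (g : ℝ[X])
    (r : ℕ) (hr : r ≠ 0) (j j' : Fin (d + 1)) (hj : (j' : ℕ) = j + 1) :
    lastRowCoeff t g r j = 2 * lastRowCoeff t g r j' + lastRowCoeff t g (r - 1) j'
        + ∑ k ∈ Finset.Iio j, t k j' * (if (j : ℕ) - k ≤ r then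
            lastRowCoeff t g (r - ((j : ℕ) - k)) k else 0) := by
  have hjd : (j : ℕ) < d := by omega
  have hj' : (⟨j + 1, by omega⟩ : Fin (d + 1)) = j' := Fin.ext hj.symm
  rw [lastRowCoeff, dif_pos hjd, dif_neg hr]
  simp only [hj']
  congr 1
  rw [← Finset.sum_subset (Finset.subset_univ (Finset.Iio j))]
  · refine Finset.sum_congr rfl fun k hk => ?_
    have hk' : (k : ℕ) < j := Fin.lt_def.1 (Finset.mem_Iio.1 hk)
    by_cases h : (j : ℕ) - k ≤ r
    · rw [dif_pos ⟨hk', h⟩, if_pos h]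
    · rw [dif_neg fun h' => h h'.2, if_neg h, mul_zero]
  · intro k _ hk
    exact dif_neg fun h' => hk (Finset.mem_Iio.2 h'.1)

/-- The equations of the linear system, solved for the Taylor coefficient of `h_{j-1}`. -/
theorem lastRowDefect_coeff_eq_zero_iff {d : ℕ} (t : Matrix (Fin (d + 1)) (Fin (d + 1)) ℝ)
    (ht : IsTaylorCoeff t) (h : Fin (d + 1) → ℝ[X]) (r : ℕ) (hr : r ≠ 0) (j j' : Fin (d + 1))
    (hj : (j' : ℕ) = j + 1) :
    ((derivative^[r]) (lastRowDefect t h j')).eval 1 = 0 ↔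
      (taylor 1 (h j)).coeff r = 2 * (taylor 1 (h j')).coeff r + (taylor 1 (h j')).coeff (r - 1)
        + ∑ k ∈ Finset.Iio j, t k j' * (if (j : ℕ) - k ≤ r then
            (taylor 1 (h k)).coeff (r - ((j : ℕ) - k)) else 0) := by
  have hins : Finset.Iio j' = insert j (Finset.Iio j) := by
    ext k
    simp only [Finset.mem_Iio, Finset.mem_insert, Fin.lt_def, Fin.ext_iff]
    omega
  rw [iterate_derivative_eval_one, mul_eq_zero_iff_left (by positivity),
    taylor_lastRowDefect_coeff _ _ _ _ (by omega), hins, Finset.sum_insert (by simp), ht.2 _ _ hj]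
  have h1 : (j' : ℕ) - 1 - j = 0 := by omega
  have h2 : ∀ k : Fin (d + 1), (j' : ℕ) - 1 - k = j - k := fun k => by omega
  simp only [h1, h2, Nat.zero_le, if_true, Nat.sub_zero]
  constructor <;> intro h <;> linarith

/-- The polynomials solving the linear system. -/
noncomputable def lastRowSolution {d : ℕ} (t : Matrix (Fin (d + 1)) (Fin (d + 1)) ℝ) (g : ℝ[X])
    (j : Fin (d + 1)) : ℝ[X] :=
  if (j : ℕ) < d then
    taylor (-1) (∑ r ∈ Finset.range (j + 2), monomial r (lastRowCoeff t g r j))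
  else g

theorem taylor_lastRowSolution {d : ℕ} (t : Matrix (Fin (d + 1)) (Fin (d + 1)) ℝ) (g : ℝ[X])
    (j : Fin (d + 1)) (hj : (j : ℕ) < d) :
    taylor 1 (lastRowSolution t g j)
      = ∑ r ∈ Finset.range (j + 2), monomial r (lastRowCoeff t g r j) := by
  rw [lastRowSolution, if_pos hj, taylor_taylor]
  simp

theorem taylor_lastRowSolution_coeff {d : ℕ} (t : Matrix (Fin (d + 1)) (Fin (d + 1)) ℝ)
    (g : ℝ[X]) (j : Fin (d + 1)) (r : ℕ) (hr : r ≤ j + 1) :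
    (taylor 1 (lastRowSolution t g j)).coeff r = lastRowCoeff t g r j := by
  by_cases hj : (j : ℕ) < d
  · rw [taylor_lastRowSolution t g j hj, finsetSum_coeff]
    simp only [coeff_monomial]
    rw [Finset.sum_ite_eq' (Finset.range (j + 2)) r, if_pos (Finset.mem_range.2 (by omega))]
  · rw [lastRowCoeff_of_not_lt t g r j hj, lastRowSolution, if_neg hj]

theorem eval_one_eq_taylor_coeff (p : ℝ[X]) : p.eval 1 = (taylor 1 p).coeff 0 := by
  rw [taylor_coeff_zero]

theorem isLastRowSolution_lastRowSolution {d : ℕ} (t : Matrix (Fin (d + 1)) (Fin (d + 1)) ℝ)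
    (ht : IsTaylorCoeff t) (g : ℝ[X]) (hg : g.eval 1 = 1) :
    IsLastRowSolution t g (lastRowSolution t g) := by
  refine ⟨if_neg (by simp), fun j hj => ?_, fun j => ?_, fun j r hr hrj => ?_⟩
  · rw [← natDegree_taylor (lastRowSolution t g j) 1, taylor_lastRowSolution t g j hj]
    refine natDegree_sum_le_of_forall_le _ _ fun r hr => (natDegree_monomial_le _).trans ?_
    have := Finset.mem_range.1 hr
    omega
  · rw [eval_one_eq_taylor_coeff, taylor_lastRowSolution_coeff t g j 0 (by omega)]
    by_cases hj : (j : ℕ) < d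
    · exact lastRowCoeff_zero t g j hj
    · rw [lastRowCoeff_of_not_lt t g 0 j hj, ← eval_one_eq_taylor_coeff, hg,
        Nat.sub_eq_zero_of_le (by omega), pow_zero]
  · have hj0 : (⟨(j : ℕ) - 1, by omega⟩ : Fin (d + 1)).val + 1 = j := by
      change (j : ℕ) - 1 + 1 = j
      omega
    set i : Fin (d + 1) := ⟨(j : ℕ) - 1, by omega⟩
    rw [lastRowDefect_coeff_eq_zero_iff t ht _ r (by omega) i j hj0.symm,
      taylor_lastRowSolution_coeff t g _ _ (by omega),
      taylor_lastRowSolution_coeff t g _ _ (by omega),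
      taylor_lastRowSolution_coeff t g _ _ (by omega),
      lastRowCoeff_of_ne_zero t g r (by omega) i j hj0.symm]
    congr 1
    refine Finset.sum_congr rfl fun k hk => ?_
    have hk' : (k : ℕ) < i := Fin.lt_def.1 (Finset.mem_Iio.1 hk)
    rw [taylor_lastRowSolution_coeff t g _ _ (by omega)]

/-- The equations force the recursion of `lastRowCoeff`. The range `r ≤ j + 1` is inherited by every
term used, since `r - (j - k) ≤ k + 1`. -/
theorem IsLastRowSolution.taylor_coeff_eq {d : ℕ} {t : Matrix (Fin (d + 1)) (Fin (d + 1)) ℝ}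
    (ht : IsTaylorCoeff t) {g : ℝ[X]} {h : Fin (d + 1) → ℝ[X]} (hh : IsLastRowSolution t g h)
    (r : ℕ) (j : Fin (d + 1)) (hr : r ≤ j + 1) :
    (taylor 1 (h j)).coeff r = lastRowCoeff t g r j := by
  obtain ⟨hg, -, h1, hq⟩ := hh
  induction r using Nat.strong_induction_on generalizing j with
  | _ r ihr =>
    induction hi : d - (j : ℕ) generalizing j with
    | zero =>
      obtain rfl : j = Fin.last d := Fin.ext (by simp only [Fin.val_last]; omega)
      rw [lastRowCoeff_of_not_lt t g r _ (by simp), hg]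
    | succ i ih =>
      have hj : (j : ℕ) < d := by omega
      rcases Nat.eq_zero_or_pos r with rfl | hr0
      · rw [lastRowCoeff_zero t g j hj, ← eval_one_eq_taylor_coeff, h1]
      · let j' : Fin (d + 1) := ⟨j + 1, by omega⟩
        have hj' : (j' : ℕ) = j + 1 := rfl
        rw [lastRowCoeff_of_ne_zero t g r hr0.ne' j j' hj',
          (lastRowDefect_coeff_eq_zero_iff t ht h r hr0.ne' j j' hj').1 (hq j' r hr0 hr),
          ih j' (by omega) (by omega), ihr (r - 1) (by omega) j' (by omega)]
        congr 1
        refine Finset.sum_congr rfl fun k hk => ?_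
        have hk' : (k : ℕ) < j := Fin.lt_def.1 (Finset.mem_Iio.1 hk)
        split_ifs with hkr
        · rw [ihr _ (by omega) k (by omega)]
        · rfl

theorem existsUnique_isLastRowSolution {d : ℕ} (t : Matrix (Fin (d + 1)) (Fin (d + 1)) ℝ)
    (ht : IsTaylorCoeff t) (g : ℝ[X]) (hg : g.eval 1 = 1) :
    ∃! h : Fin (d + 1) → ℝ[X], IsLastRowSolution t g h := by
  refine ⟨_, isLastRowSolution_lastRowSolution t ht g hg, fun h hh => ?_⟩
  ext1 j
  by_cases hj : (j : ℕ) < d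
  · apply taylor_injective 1
    have hs := isLastRowSolution_lastRowSolution t ht g hg
    ext r
    by_cases hr : r ≤ j + 1
    · rw [hh.taylor_coeff_eq ht r j hr, hs.taylor_coeff_eq ht r j hr]
    · rw [coeff_eq_zero_of_natDegree_lt, coeff_eq_zero_of_natDegree_lt]
      · rw [natDegree_taylor]
        exact (hs.2.1 j hj).trans_lt (by omega)
      · rw [natDegree_taylor]
        exact (hh.2.1 j hj).trans_lt (by omega)
  · obtain rfl : j = Fin.last d := Fin.ext (by simp only [Fin.val_last]; omega)
    rw [hh.1, lastRowSolution, if_neg hj]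

/-- The polynomial `q_j` is divisible by `(X - 1) ^ j`. -/
theorem IsLastRowSolution.pow_dvd_lastRowDefect {d : ℕ}
    {t : Matrix (Fin (d + 1)) (Fin (d + 1)) ℝ} (ht : IsTaylorCoeff t) {g : ℝ[X]}
    {h : Fin (d + 1) → ℝ[X]} (hh : IsLastRowSolution t g h) (j : Fin (d + 1)) :
    (X - 1) ^ (j : ℕ) ∣ lastRowDefect t h j := by
  have hX : X ^ (j : ℕ) ∣ taylor 1 (lastRowDefect t h j) := by
    refine X_pow_dvd_iff.2 fun r hr => ?_
    -- Order zero is not among the equations: at `1` the terms `2 h_j(1)` and `-h_{j-1}(1)` cancel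
    -- by the prescribed values.
    rcases Nat.eq_zero_or_pos r with rfl | hr0
    · have hj0 : (⟨(j : ℕ) - 1, by omega⟩ : Fin (d + 1)).val + 1 = j := by
        change (j : ℕ) - 1 + 1 = j
        omega
      set i : Fin (d + 1) := ⟨(j : ℕ) - 1, by omega⟩
      rw [← eval_one_eq_taylor_coeff, lastRowDefect, eval_add, eval_finsetSum,
        Finset.sum_eq_single i]
      · have h1 : (j : ℕ) - 1 - i = 0 := by omega
        have h2 : d - (i : ℕ) = d - (j : ℕ) + 1 := by omega
        rw [h1, ht.2 i j hj0.symm]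
        simp only [eval_mul, eval_add, eval_X, eval_one, hh.2.2.1, h2, pow_succ, eval_C, pow_zero]
        ring
      · intro k hk hki
        have hk' : (k : ℕ) < j := Fin.lt_def.1 (Finset.mem_Iio.1 hk)
        have hki' : (k : ℕ) ≠ i := fun h => hki (Fin.ext h)
        have h1 : (j : ℕ) - 1 - k ≠ 0 := by omega
        simp [h1]
      · intro hi
        exact absurd (Finset.mem_Iio.2 (Fin.lt_def.2 (by omega))) hi
    · have h1 := hh.2.2.2 j r hr0 hr.le
      rw [iterate_derivative_eval_one] at h1
      exact (mul_eq_zero_iff_left (by positivity)).1 h1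
  obtain ⟨ρ, hρ⟩ := hX
  refine ⟨taylor (-1) ρ, taylor_injective 1 ?_⟩
  rw [hρ, taylor_mul, taylor_pow, map_sub, taylor_X, taylor_one, taylor_taylor]
  simp

/-! ### The column that the Taylor symbol maps to the last coordinate. -/

/-- The polynomials `p_j` with `p_j (1) = 1` for which `(X - 1) ^ j p_j`, `0 ≤ j ≤ d`, is mapped by
the symbol of the Taylor operator to a multiple of the last unit vector. -/
noncomputable def taylorFactor {d : ℕ} (t : Matrix (Fin (d + 1)) (Fin (d + 1)) ℝ)
    (j : Fin (d + 1)) : ℝ[X] :=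
  if (j : ℕ) < d then
    -∑ k : Fin (d + 1), if h : (j : ℕ) < k then
      C (t j k) * (X - 1) ^ ((k : ℕ) - j - 1) * taylorFactor t k else 0
  else 1
termination_by d - (j : ℕ)

/-- At `1` only the term `k = j + 1` survives, with coefficient `-t_{j,j+1} = 1`. -/
theorem taylorFactor_eval_one {d : ℕ} {t : Matrix (Fin (d + 1)) (Fin (d + 1)) ℝ}
    (ht : IsTaylorCoeff t) (j : Fin (d + 1)) : (taylorFactor t j).eval 1 = 1 := by
  induction hi : d - (j : ℕ) generalizing j with
  | zero => rw [taylorFactor, if_neg (by omega), eval_one]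
  | succ i ih =>
    have hj : (j : ℕ) < d := by omega
    let j' : Fin (d + 1) := ⟨j + 1, by omega⟩
    have hj' : (j' : ℕ) = j + 1 := rfl
    rw [taylorFactor, if_pos hj, eval_neg, eval_finsetSum, Finset.sum_eq_single j']
    · rw [dif_pos (by omega), ht.2 j j' hj', eval_mul, ih j' (by omega), hj']
      simp
    · intro k _ hk
      have hk' : (k : ℕ) ≠ j' := fun h => hk (Fin.ext h)
      split_ifs with h
      · have h1 : (k : ℕ) - j - 1 ≠ 0 := by omega
        simp [h1]
      · exact eval_zero
    · simp

theorem taylorPoly_mul_taylorFactor {d : ℕ} {t : Matrix (Fin (d + 1)) (Fin (d + 1)) ℝ}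
    (ht : IsTaylorCoeff t) (j : Fin (d + 1)) :
    ∑ k, taylorPoly t j k * ((X - 1) ^ (k : ℕ) * taylorFactor t k)
      = if j = Fin.last d then (X - 1) ^ (d + 1) else 0 := by
  simp only [taylorPoly_apply, add_mul, Finset.sum_add_distrib, ite_mul, zero_mul,
    Finset.sum_ite_eq, Finset.mem_univ, if_true]
  by_cases hj : (j : ℕ) < d
  · rw [if_neg fun h => by simp [h] at hj, taylorFactor, if_pos hj, ← mul_assoc, mul_neg,
      neg_add_eq_zero, Finset.mul_sum]
    refine Finset.sum_congr rfl fun k _ => ?_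
    split_ifs with h
    · rw [show (X - 1 : ℝ[X]) ^ (k : ℕ) = (X - 1) * (X - 1) ^ (j : ℕ) * (X - 1) ^ ((k : ℕ) - j - 1) by
        rw [← pow_succ', ← pow_add]
        congr 1
        omega]
      ring
    · rw [ht.1 j k (Fin.le_def.2 (by omega))]
      simp
  · obtain rfl : j = Fin.last d := Fin.ext (by simp only [Fin.val_last]; omega)
    rw [if_pos rfl, taylorFactor, if_neg hj, Finset.sum_eq_zero fun k _ => by
      rw [ht.1 _ k (Fin.le_last k)]; simp]
    simp [pow_succ']

/-! ### Hermite schemes with rank-one symbol: convergence and non-degeneracy. -/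

theorem hermiteD_inv (d : ℕ) :
    (hermiteD d)⁻¹ = Matrix.diagonal fun k : Fin (d + 1) => (2 : ℝ) ^ (k : ℕ) := by
  refine Matrix.inv_eq_left_inv ?_
  rw [hermiteD, Matrix.diagonal_mul_diagonal, ← Matrix.diagonal_one]
  congr 1
  ext k
  rw [← mul_pow]
  norm_num

/-- The factors `D^n` and `D^{-n}` of consecutive levels telescope. -/
theorem hermiteSeq_polyMask {d : ℕ} (P : Matrix (Fin (d + 1)) (Fin (d + 1)) ℝ[X]) (f₀ : VecSeq d)
    (n : ℕ) (α : ℤ) (i : Fin (d + 1)) :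
    hermiteSeq (polyMask P) f₀ n α i
      = ((2 : ℝ) ^ n) ^ (i : ℕ) * ((subdivOp (polyMask P))^[n] f₀) α i := by
  induction n generalizing α i with
  | zero => simp [hermiteSeq]
  | succ n ih =>
    have h1 : (fun α => (hermiteD d)⁻¹ ^ (n + 1) * polyMask P α * hermiteD d ^ n)
        = polyMask (Matrix.of fun i j =>
          C (((2 : ℝ) ^ (n + 1)) ^ (i : ℕ) * ((1 / 2 : ℝ) ^ n) ^ (j : ℕ)) * P i j) := by
      ext γ i j
      rw [hermiteD_inv, hermiteD, Matrix.diagonal_pow, Matrix.diagonal_pow, Matrix.mul_diagonal,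
        Matrix.diagonal_mul]
      simp only [polyMask, Matrix.of_apply, Pi.pow_apply, intCoeff, coeff_C_mul]
      split_ifs
      · rw [pow_right_comm, pow_right_comm (1 / 2 : ℝ)]
        ring
      · simp
    have h2 : ∀ j, (fun β => hermiteSeq (polyMask P) f₀ n β j)
        = ((2 : ℝ) ^ n) ^ (j : ℕ) • fun β => ((subdivOp (polyMask P))^[n] f₀) β j := fun j =>
      funext fun β => ih β j
    rw [hermiteSeq, h1, subdivOp_polyMask, Function.iterate_succ_apply', subdivOp_polyMask,
      Finset.mul_sum]
    refine Finset.sum_congr rfl fun j _ => ?_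
    rw [Matrix.of_apply, aeval_C_mul_seqShift, h2, map_smul, map_smul, smul_smul, Pi.smul_apply,
      smul_eq_mul, mul_assoc (((2 : ℝ) ^ (n + 1)) ^ (i : ℕ)), ← mul_pow, ← mul_pow]
    norm_num

/-- The polynomial matrix with entries `(X - 1) ^ i p_i r_j`. -/
noncomputable def rankOneSymbol {d : ℕ} (p r : Fin (d + 1) → ℝ[X]) :
    Matrix (Fin (d + 1)) (Fin (d + 1)) ℝ[X] :=
  Matrix.of fun i j => ((X - 1) ^ (i : ℕ) * p i) * r j

/-- The scalar sequence `∑_j S_{r_j} c_j`. -/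
noncomputable def scalarPart {d : ℕ} (r : Fin (d + 1) → ℝ[X]) (c : VecSeq d) : ℤ → ℝ :=
  ∑ j, aeval seqShift (r j) (upsample fun β => c β j)

/-- The limit function of the Hermite scheme of `rankOneSymbol`. -/
noncomputable def splineLimit {d : ℕ} (r : Fin (d + 1) → ℝ[X]) (c : VecSeq d) (x : ℝ)
    (i : Fin (d + 1)) : ℝ :=
  2 ^ (i : ℕ) * splineFun (d - i + 1) ((seqDiff ^ (i : ℕ)) (scalarPart r c)) (2 * x)

theorem subdivOp_rankOneSymbol {d : ℕ} (p r : Fin (d + 1) → ℝ[X]) (c : VecSeq d) :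
    subdivOp (polyMask (rankOneSymbol p r)) c
      = fun α (i : Fin (d + 1)) =>
        aeval seqShift ((X - 1) ^ (i : ℕ) * p i) (scalarPart r c) α := by
  ext α i
  rw [subdivOp_polyMask, scalarPart, map_sum, Finset.sum_apply]
  simp only [rankOneSymbol, Matrix.of_apply, aeval_mul_seqShift]

/-- On sequences of the form `v(E) u` the vector scheme is thereby the scalar spline scheme acting
on `u`. -/
theorem scalarPart_shift {d : ℕ} {p r : Fin (d + 1) → ℝ[X]}
    (hs : ∑ j, r j * expand ℝ 2 ((X - 1) ^ (j : ℕ) * p j) = splineSymbol (d + 1)) (u : ℤ → ℝ) :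
    scalarPart r (fun α (i : Fin (d + 1)) => aeval seqShift ((X - 1) ^ (i : ℕ) * p i) u α)
      = splineOp (d + 1) u := by
  rw [splineOp, ← hs, map_sum, LinearMap.sum_apply, scalarPart]
  refine Finset.sum_congr rfl fun j _ => ?_
  rw [aeval_mul_seqShift (r j), ← upsample_aeval]

theorem subdivOp_rankOneSymbol_iterate {d : ℕ} {p r : Fin (d + 1) → ℝ[X]}
    (hs : ∑ j, r j * expand ℝ 2 ((X - 1) ^ (j : ℕ) * p j) = splineSymbol (d + 1))
    (c : VecSeq d) (n : ℕ) :
    (subdivOp (polyMask (rankOneSymbol p r)))^[n + 1] c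
      = fun α (i : Fin (d + 1)) => aeval seqShift ((X - 1) ^ (i : ℕ) * p i)
        ((splineOp (d + 1))^[n] (scalarPart r c)) α := by
  induction n with
  | zero => exact subdivOp_rankOneSymbol p r c
  | succ n ih =>
    rw [Function.iterate_succ_apply', ih, subdivOp_rankOneSymbol, scalarPart_shift hs,
      Function.iterate_succ_apply']

/-- The scaling `2^{(n+1)i}` meets the factor `2^{-ni}` from differencing the `n` spline steps;
`2^i` remains. -/
theorem hermiteSeq_rankOneSymbol {d : ℕ} {p r : Fin (d + 1) → ℝ[X]}
    (hs : ∑ j, r j * expand ℝ 2 ((X - 1) ^ (j : ℕ) * p j) = splineSymbol (d + 1))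
    (c : VecSeq d) (n : ℕ) (α : ℤ) (i : Fin (d + 1)) :
    hermiteSeq (polyMask (rankOneSymbol p r)) c (n + 1) α i
      = 2 ^ (i : ℕ) * aeval seqShift (p i)
        ((splineOp (d - i + 1))^[n] ((seqDiff ^ (i : ℕ)) (scalarPart r c))) α := by
  have hd : splineOp (d + 1) = splineOp ((d - i + 1) + i) := by
    congr 1
    omega
  have hX : aeval seqShift ((X - 1 : ℝ[X]) ^ (i : ℕ)) = seqDiff ^ (i : ℕ) := by
    rw [map_pow, seqDiff]
  rw [hermiteSeq_polyMask, subdivOp_rankOneSymbol_iterate hs]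
  beta_reduce
  rw [mul_comm ((X - 1) ^ (i : ℕ)) (p i), aeval_mul_seqShift, hX, hd,
    seqDiff_pow_splineOp_iterate, map_smul, Pi.smul_apply, smul_eq_mul, ← mul_assoc, ← mul_pow,
    pow_succ, mul_right_comm, ← mul_pow]
  norm_num

theorem continuous_splineLimit {d : ℕ} (r : Fin (d + 1) → ℝ[X]) (c : VecSeq d) :
    Continuous (splineLimit r c) :=
  continuous_pi fun _ => continuous_const.mul
    ((continuous_splineFun_succ _ _).comp (continuous_const.mul continuous_id))

theorem isHermiteLimit_splineLimit {d : ℕ} {p r : Fin (d + 1) → ℝ[X]}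
    (hs : ∑ j, r j * expand ℝ 2 ((X - 1) ^ (j : ℕ) * p j) = splineSymbol (d + 1))
    (hp : ∀ i, (p i).eval 1 = 1) (c : VecSeq d) :
    IsHermiteLimit (polyMask (rankOneSymbol p r)) c (splineLimit r c) := by
  refine ⟨continuous_splineLimit r c, fun K hK => ?_⟩
  obtain ⟨R, hR⟩ := hK.isBounded.exists_norm_le
  -- The first step only produces `scalarPart`, so level `n + 1` corresponds to spline level `n`,
  -- and the radius doubles.
  choose L hL using fun i : Fin (d + 1) => exists_abs_aeval_splineOp_iterate_sub_le (d - i) (p i)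
    (hp i) ((seqDiff ^ (i : ℕ)) (scalarPart r c)) (2 * R)
  choose M hM0 hM using fun i : Fin (d + 1) => exists_abs_le_of_abs_le
    (fun α : ℤ => c α i - splineLimit r c α i) R
  -- Level zero is the arbitrary initial data and gets a bound of its own.
  refine ⟨fun n => if n = 0 then ∑ i, M i
    else (∑ i : Fin (d + 1), 2 ^ (i : ℕ) * |L i|) * (1 / 2) ^ (n - 1), ?_, ?_⟩
  · rw [← Filter.tendsto_add_atTop_iff_nat 1]
    simp only [Nat.succ_ne_zero, if_false, Nat.add_sub_cancel]
    have h := (tendsto_pow_atTop_nhds_zero_of_lt_one (by norm_num : (0 : ℝ) ≤ 1 / 2)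
      (by norm_num)).const_mul (∑ i : Fin (d + 1), 2 ^ (i : ℕ) * |L i|)
    rwa [mul_zero] at h
  · intro n α hα i
    have hα' := hR _ hα
    beta_reduce
    rcases n with _ | n
    · rw [if_pos rfl]
      simp only [pow_zero, div_one] at hα' ⊢
      exact (hM i α hα').trans
        (Finset.single_le_sum (f := M) (fun i _ => hM0 i) (Finset.mem_univ i))
    · rw [if_neg (Nat.succ_ne_zero n), Nat.add_sub_cancel, hermiteSeq_rankOneSymbol hs,
        splineLimit, ← mul_sub, abs_mul, abs_of_pos (by positivity : (0 : ℝ) < 2 ^ (i : ℕ))]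
      have h2 : 2 * ((α : ℝ) / 2 ^ (n + 1)) = α / 2 ^ n := by
        rw [pow_succ]
        field_simp
      have hα2 : |(α : ℝ)| ≤ 2 ^ n * (2 * R) := by
        rw [Real.norm_eq_abs, abs_div, abs_of_pos (by positivity : (0 : ℝ) < 2 ^ (n + 1)),
          div_le_iff₀ (by positivity), pow_succ] at hα'
        linarith
      rw [h2]
      have h3 := hL i n α hα2
      calc _ ≤ 2 ^ (i : ℕ) * (|L i| * (1 / 2) ^ n) := by
            refine mul_le_mul_of_nonneg_left (h3.trans ?_) (by positivity)
            exact mul_le_mul_of_nonneg_right (le_abs_self _) (by positivity)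
        _ = (2 ^ (i : ℕ) * |L i|) * (1 / 2) ^ n := by ring
        _ ≤ _ := by
            refine mul_le_mul_of_nonneg_right ?_ (by positivity)
            exact Finset.single_le_sum (f := fun i : Fin (d + 1) => 2 ^ (i : ℕ) * |L i|)
              (fun i _ => by positivity) (Finset.mem_univ i)

theorem iteratedDeriv_splineFun (m i : ℕ) (u : ℤ → ℝ) :
    iteratedDeriv i (fun x => splineFun (m + i + 1) u (2 * x))
      = fun x => 2 ^ i * splineFun (m + 1) ((seqDiff ^ i) u) (2 * x) := by
  induction i generalizing m with
  | zero => simp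
  | succ i ih =>
    rw [iteratedDeriv_succ, show m + (i + 1) + 1 = m + 1 + i + 1 by ring, ih]
    ext x
    have h := ((hasDerivAt_splineFun m ((seqDiff ^ i) u) (2 * x)).comp x
      ((hasDerivAt_id x).const_mul 2)).const_mul (2 ^ i)
    refine h.deriv.trans ?_
    rw [pow_succ' seqDiff, Module.End.mul_apply]
    ring

theorem contDiff_splineFun (m : ℕ) (u : ℤ → ℝ) : ContDiff ℝ m (splineFun (m + 1) u) := by
  induction m generalizing u with
  | zero => exact contDiff_zero.2 (continuous_splineFun_succ 0 u)
  | succ m ih =>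
    rw [Nat.cast_succ, contDiff_succ_iff_deriv]
    refine ⟨fun x => (hasDerivAt_splineFun m u x).differentiableAt, by simp, ?_⟩
    rw [show deriv (splineFun (m + 1 + 1) u) = splineFun (m + 1) (seqDiff u) from
      funext fun x => (hasDerivAt_splineFun m u x).deriv]
    exact ih _

theorem isHermiteConvergent_rankOneSymbol {d : ℕ} {p r : Fin (d + 1) → ℝ[X]}
    (hs : ∑ j, r j * expand ℝ 2 ((X - 1) ^ (j : ℕ) * p j) = splineSymbol (d + 1))
    (hp : ∀ i, (p i).eval 1 = 1) : IsHermiteConvergent d (polyMask (rankOneSymbol p r)) := by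
  intro c
  have h0 : (fun x => splineLimit r c x 0)
      = fun x => splineFun (d + 1) (scalarPart r c) (2 * x) := by
    ext x
    simp [splineLimit]
  refine ⟨splineLimit r c, isHermiteLimit_splineLimit hs hp c, ?_, fun i => ?_⟩
  · rw [h0]
    exact (contDiff_splineFun d _).comp (contDiff_const.mul contDiff_id)
  · rw [h0]
    have h := iteratedDeriv_splineFun (d - i) i (scalarPart r c)
    rw [Nat.sub_add_cancel (Nat.le_of_lt_succ i.2)] at h
    exact h

theorem seqDiff_pow_pow (k : ℕ) :
    (seqDiff ^ k) (fun α : ℤ => (α : ℝ) ^ k) = fun _ => (k.factorial : ℝ) := by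
  have h : ∀ (k : ℕ) (f : ℝ → ℝ),
      (seqDiff ^ k) (fun α : ℤ => f α) = fun α : ℤ => (fwdDiff 1)^[k] f α := by
    intro k
    induction k with
    | zero => intro f; rfl
    | succ k ih =>
      intro f
      rw [pow_succ, Module.End.mul_apply, Function.iterate_succ_apply, ← ih]
      congr 1
      ext α
      rw [seqDiff_apply, fwdDiff]
      push_cast
      rfl
  refine (h k (fun x => x ^ k)).trans (funext fun α => ?_)
  rw [fwdDiff_iter_eq_factorial]
  rfl

theorem splineFun_const (m : ℕ) (a x : ℝ) : splineFun m (fun _ => a) x = a := by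
  have h := abs_splineFun_sub_le m (fun _ => a) a 0 x fun β _ _ => by simp
  exact sub_eq_zero.1 (abs_nonpos_iff.1 h)

theorem exists_splineLimit_ne_zero {d : ℕ} {p r : Fin (d + 1) → ℝ[X]}
    (hs : ∑ j, r j * expand ℝ 2 ((X - 1) ^ (j : ℕ) * p j) = splineSymbol (d + 1)) :
    ∃ (c : VecSeq d) (x : ℝ), splineLimit r c x (Fin.last d) ≠ 0 := by
  -- The initial data `v(E) α^d` reduce to a spline step applied to `α^d`, whose `d`-th difference
  -- is a nonzero constant.
  refine ⟨fun α i => aeval seqShift ((X - 1) ^ (i : ℕ) * p i) (fun α : ℤ => (α : ℝ) ^ d) α, 0, ?_⟩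
  rw [splineLimit, scalarPart_shift hs, Fin.val_last, Nat.sub_self, zero_add]
  have h := seqDiff_pow_splineOp_iterate 1 1 d (fun α : ℤ => (α : ℝ) ^ d)
  rw [Function.iterate_one, Function.iterate_one, add_comm 1 d] at h
  rw [h, splineFun_smul, splineFun_splineOp, seqDiff_pow_pow, splineFun_const]
  positivity

/-! ### Contractivity, and assembly of the masks. -/

/-- A mask with only its last row non-zero and the entry `(X + 1) / 2` on the diagonal is
contractive. -/
theorem isContractive_lastRow {d : ℕ} (b : Fin (d + 1) → ℝ[X])
    (hb : b (Fin.last d) = C (1 / 2) * (X + 1)) :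
    IsContractive (polyMask (Matrix.of fun i j => if i = Fin.last d then b j else 0)) := by
  set Q : Matrix (Fin (d + 1)) (Fin (d + 1)) ℝ[X] :=
    Matrix.of fun i j => if i = Fin.last d then b j else 0 with hQ
  have hne : ∀ (c : VecSeq d) (α : ℤ) (i : Fin (d + 1)), i ≠ Fin.last d →
      subdivOp (polyMask Q) c α i = 0 := by
    intro c α i hi
    rw [subdivOp_polyMask]
    simp [hQ, hi]
  set L : ℝ := ∑ j, ∑ k ∈ Finset.range ((b j).natDegree + 1), |(b j).coeff k| with hL
  have hfirst : ∀ (c : VecSeq d) (M : ℝ), 0 ≤ M → (∀ α i, |c α i| ≤ M) → ∀ α i,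
      |subdivOp (polyMask Q) c α i| ≤ L * M := by
    intro c M hM0 hM α i
    have hL0 : 0 ≤ L :=
      Finset.sum_nonneg fun _ _ => Finset.sum_nonneg fun _ _ => abs_nonneg _
    by_cases hi : i = Fin.last d
    · rw [subdivOp_polyMask, hL, Finset.sum_mul]
      refine (Finset.abs_sum_le_sum_abs _ _).trans (Finset.sum_le_sum fun j _ => ?_)
      simp only [hQ, Matrix.of_apply, if_pos hi]
      refine abs_aeval_seqShift_le _ _ _ _ fun β _ _ => ?_
      rw [upsample_apply]
      split_ifs
      · exact hM _ _
      · simpa using hM0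
    · rw [hne c α i hi, abs_zero]
      positivity
  have hstep : ∀ (c : VecSeq d) (M : ℝ), (∀ α i, i ≠ Fin.last d → c α i = 0) →
      (∀ α i, |c α i| ≤ M) → ∀ α i, |subdivOp (polyMask Q) c α i| ≤ 1 / 2 * M := by
    intro c M h0 hM α i
    have hM0 : 0 ≤ M := (abs_nonneg _).trans (hM 0 0)
    by_cases hi : i = Fin.last d
    · rw [subdivOp_polyMask, Finset.sum_eq_single (Fin.last d)]
      · simp only [hQ, Matrix.of_apply, if_pos hi, hb, aeval_C_mul_seqShift, Pi.smul_apply,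
          smul_eq_mul]
        rw [abs_mul, abs_of_pos (by norm_num : (0 : ℝ) < 1 / 2)]
        refine mul_le_mul_of_nonneg_left ?_ (by norm_num)
        have h := splineOp_zero_apply (fun β => c β (Fin.last d)) α
        rw [splineOp, splineSymbol, pow_zero, one_mul] at h
        rw [h]
        exact hM _ _
      · intro j _ hj
        have hz : (fun β => c β j) = 0 := funext fun β => h0 β j hj
        rw [hz, map_zero, map_zero]
        rfl
      · simp
    · rw [hne c α i hi, abs_zero]
      positivity
  have hiter : ∀ (n : ℕ) (c : VecSeq d) (M : ℝ), 0 ≤ M → (∀ α i, |c α i| ≤ M) → ∀ α i,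
      |((subdivOp (polyMask Q))^[n + 1] c) α i| ≤ (1 / 2) ^ n * (L * M) := by
    intro n c M hM0 hM
    induction n with
    | zero => simpa using hfirst c M hM0 hM
    | succ n ih =>
      intro α i
      rw [Function.iterate_succ_apply', pow_succ', mul_assoc]
      refine hstep _ _ (fun β j hj => ?_) ih α i
      rw [Function.iterate_succ_apply']
      exact hne _ _ _ hj
  have hlim := (tendsto_pow_atTop_nhds_zero_of_lt_one (by norm_num : (0 : ℝ) ≤ 1 / 2)
    (by norm_num)).mul_const L
  rw [zero_mul] at hlim
  obtain ⟨n, hn⟩ := (hlim.eventually_lt_const (zero_lt_one' ℝ)).exists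
  -- The first step may expand by `L`; each later one halves the norm, so a large `n` compensates.
  refine ⟨n + 1, (1 / 2) ^ n * L, hn, fun c M hM α i => ?_⟩
  rw [mul_assoc]
  exact hiter n c M ((abs_nonneg _).trans (hM 0 0)) hM α i

/-- The last row of the symbol identity `T A = 2^{-d} B T(X²)`. -/
theorem lastRow_mul_taylorPoly {d : ℕ} {t : Matrix (Fin (d + 1)) (Fin (d + 1)) ℝ}
    (ht : IsTaylorCoeff t) (h : Fin (d + 1) → ℝ[X]) (k : Fin (d + 1)) :
    ∑ j : Fin (d + 1), (X - 1) ^ (d - (j : ℕ)) * h j * expand ℝ 2 (taylorPoly t j k)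
      = (X - 1) ^ (d + 1 - (k : ℕ)) * lastRowDefect t h k := by
  have h1 : ∀ j : Fin (d + 1), expand ℝ 2 (taylorPoly t j k)
      = (if j = k then (X - 1) * (X + 1) else 0) + C (t j k) := by
    intro j
    rw [taylorPoly_apply, map_add, expand_C]
    split_ifs
    · rw [map_sub, expand_X, map_one]
      ring
    · rw [map_zero]
  have hk : (k : ℕ) ≤ d := Nat.le_of_lt_succ k.2
  simp only [h1, mul_add, Finset.sum_add_distrib, mul_ite, mul_zero, Finset.sum_ite_eq',
    Finset.mem_univ, if_true]
  rw [lastRowDefect, mul_add, Finset.mul_sum,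
    ← Finset.sum_subset (Finset.subset_univ (Finset.Iio k))]
  · congr 1
    · rw [Nat.succ_sub hk, pow_succ]
      ring
    · refine Finset.sum_congr rfl fun j hj => ?_
      have hj' : (j : ℕ) < k := Fin.lt_def.1 (Finset.mem_Iio.1 hj)
      rw [show d - (j : ℕ) = (d + 1 - k) + (k - 1 - j) by omega, pow_add]
      ring
  · intro j _ hj
    rw [ht.1 j k (not_lt.1 fun h => hj (Finset.mem_Iio.2 h)), C_0, mul_zero]

theorem mainTheorem6 (d : ℕ) (t : Matrix (Fin (d + 1)) (Fin (d + 1)) ℝ) (ht : IsTaylorCoeff t) :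
    (∀ g : ℝ[X], g.eval 1 = 1 → ∃! h : Fin (d + 1) → ℝ[X], IsLastRowSolution t g h) ∧
    ∃ A B : MatSeq d, IsMask A ∧ IsMask B ∧
      (∀ c : VecSeq d,
        taylorOp t (subdivOp A c) = (1 / 2 : ℝ) ^ d • subdivOp B (taylorOp t c)) ∧
      IsContractive B ∧
      IsHermiteConvergent d A ∧
      (∃ (f₀ : VecSeq d) (Φ : ℝ → Fin (d + 1) → ℝ),
        IsHermiteLimit A f₀ Φ ∧ ∃ x : ℝ, Φ x (Fin.last d) ≠ 0) ∧
      ∃ (g : ℝ[X]) (h : Fin (d + 1) → ℝ[X]), g.eval 1 = 1 ∧ IsLastRowSolution t g h ∧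
        ∀ (j : Fin (d + 1)) (z : ℂ), z ≠ 0 →
          symbol B z (Fin.last d) j = (z⁻¹ - 1) ^ (d - (j : ℕ)) * aeval z⁻¹ (h j) := by
  refine ⟨fun g hg => existsUnique_isLastRowSolution t ht g hg, ?_⟩
  -- This choice gives the contraction factor `1 / 2` and makes the scalar symbol a B-spline symbol.
  set g : ℝ[X] := C (1 / 2) * (X + 1) with hgdef
  have hg : g.eval 1 = 1 := by
    rw [hgdef, eval_mul, eval_C, eval_add, eval_X, eval_one]
    norm_num
  obtain ⟨h, hh, -⟩ := existsUnique_isLastRowSolution t ht g hg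
  choose ρ hρ using hh.pow_dvd_lastRowDefect ht
  set b : Fin (d + 1) → ℝ[X] := fun j => (X - 1) ^ (d - (j : ℕ)) * h j with hb
  set r : Fin (d + 1) → ℝ[X] := fun j => C ((1 / 2) ^ d) * ρ j with hr
  have hblast : b (Fin.last d) = C (1 / 2) * (X + 1) := by
    simp only [hb, Fin.val_last, Nat.sub_self, pow_zero, one_mul]
    exact hh.1
  have hrow : ∀ k, (X - 1) ^ (d + 1) * r k
      = C ((1 / 2) ^ d) * ∑ j, b j * expand ℝ 2 (taylorPoly t j k) := by
    intro k
    have hk : d + 1 = (d + 1 - (k : ℕ)) + k := by omega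
    simp only [hb]
    rw [lastRow_mul_taylorPoly ht, hρ, ← mul_assoc (_ ^ _) (_ ^ _) (ρ k), ← pow_add, ← hk]
    simp only [hr]
    ring
  have hs : ∑ j, r j * expand ℝ 2 ((X - 1) ^ (j : ℕ) * taylorFactor t j)
      = splineSymbol (d + 1) := by
    have hX : (X - 1 : ℝ[X]) ^ (d + 1) ≠ 0 := pow_ne_zero _ (X_sub_C_ne_zero (1 : ℝ))
    -- After multiplication by `(X - 1)^{d+1}` the row identity applies, and `T(X²) v(X²)` leaves
    -- only `b_d (X² - 1)^{d+1}`.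
    apply mul_left_cancel₀ hX
    rw [Finset.mul_sum]
    simp only [← mul_assoc, hrow]
    simp only [mul_assoc, ← Finset.mul_sum, Finset.sum_mul]
    rw [Finset.sum_comm]
    simp only [← map_mul (expand ℝ 2), ← Finset.mul_sum, ← map_sum,
      taylorPoly_mul_taylorFactor ht, apply_ite (expand ℝ 2), map_zero, mul_ite, mul_zero,
      Finset.sum_ite_eq', Finset.mem_univ, if_true]
    rw [hblast, map_pow (expand ℝ 2), map_sub, expand_X, map_one, C_pow, splineSymbol,
      show (X ^ 2 - 1 : ℝ[X]) = (X - 1) * (X + 1) by ring]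
    simp only [mul_pow]
    ring
  have hp := taylorFactor_eval_one ht
  refine ⟨polyMask (rankOneSymbol (taylorFactor t) r),
    polyMask (Matrix.of fun i j => if i = Fin.last d then b j else 0),
    isMask_polyMask _, isMask_polyMask _, ?_, isContractive_lastRow b hblast,
    isHermiteConvergent_rankOneSymbol hs hp, ?_, g, h, hg, hh, fun j z _ => ?_⟩
  · refine taylorOp_subdivOp t _ _ _ fun i k => ?_
    have h1 : ∀ j, taylorPoly t i j * rankOneSymbol (taylorFactor t) r j k
        = taylorPoly t i j * ((X - 1) ^ (j : ℕ) * taylorFactor t j) * r k := fun j =>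
      (mul_assoc _ _ _).symm
    simp only [h1, ← Finset.sum_mul, taylorPoly_mul_taylorFactor ht, Matrix.of_apply]
    by_cases hi : i = Fin.last d
    · simp only [if_pos hi]
      exact hrow k
    · simp [if_neg hi]
  · obtain ⟨c, x, hx⟩ := exists_splineLimit_ne_zero hs
    exact ⟨c, _, isHermiteLimit_splineLimit hs hp c, x, hx⟩
  · rw [symbol_polyMask, Matrix.of_apply, if_pos rfl]
    simp only [hb, map_mul, map_pow, map_sub, aeval_X, map_one]
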